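/- A \emph{triangulated diskoid} $D$ is a contractible, compact, piecewise-linear region in the plane with a finite cell structure whose 2-cells are embedded triangles (two edges may have the same endpoints, and edges need not lie in a triangle; trees and the single point are allowed). Its boundary is a clockwise oriented polygon $P$ with a boundary map $P\to D$, which need not be injective: an edge of $D$ that lies in no triangle is traversed twice. The \emph{area} of $D$ is its number of triangles. $D$ is of \emph{type $A_2$} if its edges can be labelled by the two minuscule weights $\omega_1,\omega_2=\omega_1^*$ of $A_2$, where reversing an edge dualizes its label, so that the three edges around each triangle, traversed cyclically, carry the same label. $D$ carries the intrinsic metric in which every edge has length $1$ and every triangle is an equilateral Euclidean triangle, and $D$ is $\mathrm{CAT}(0)$ if it is so for this metric. An \emph{affine building of type $A_2$} is a simplicial complex $\Delta$ with a system of subcomplexes (apartments) such that: every apartment is isomorphic to the Weyl alcove complex of type $A_2$ (the tiling of the plane by equilateral triangles); $\Delta$ is the union of its apartments; any two simplices lie in a common apartment; and if $\Sigma,\Sigma'$ are apartments and $\alpha,\alpha'$ are simplices of both, then there is an isomorphism $\Sigma\to\Sigma'$ fixing $\alpha$ and $\alpha'$ pointwise. \textbf{Theorem.} Let $D$ be a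 $\mathrm{CAT}(0)$ triangulated diskoid of type $A_2$ with boundary polygon $P$, and let $f:D\to\Delta$ be a simplicial embedding into an affine building of type $A_2$. Let $D'$ be any triangulated diskoid, with an orientation-preserving identification of its boundary polygon with $P$, and let $f':D'\to\Delta$ be any simplicial map (not necessarily injective) whose restriction to $P$ agrees with that of $f$. Then $\operatorname{area}(D)\le\operatorname{area}(D')$. If equality holds, then there is an isomorphism of triangulated diskoids $\varphi:D'\to D$ that induces the given identification of boundary polygons and satisfies $f'=f\circ\varphi$. That is, $D$ is the unique least area diskoid that extends the embedding of its boundary polygon. -/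

import Mathlib

/-! ### Affine buildings of type `A₂` -/

/-- The minuscule vectors of the coweight lattice of type `A₂`, in the basis of fundamental
coweights: the Weyl orbits of `(1, 0)` and of `(0, 1)`. -/
def minusculeA2 : Set (ℤ × ℤ) :=
  {(1, 0), (-1, 1), (0, -1), (0, 1), (1, -1), (-1, 0)}

/-- The Weyl alcove complex of type `A₂`, i.e. the tiling of the Euclidean plane by equilateral
triangles. Its vertices are the points of the coweight lattice; finitely many vertices span a
simplex exactly when any two distinct ones differ by a minuscule vector. -/
def alcoveComplexA2 : AbstractSimplicialComplex (ℤ × ℤ) where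
  faces := {s | s.Nonempty ∧ ∀ x ∈ s, ∀ y ∈ s, x ≠ y → x - y ∈ minusculeA2}
  isRelLowerSet_faces := fun _ hs =>
    ⟨hs.1, fun _ hts ht => ⟨ht, fun x hx y hy => hs.2 x (hts hx) y (hts hy)⟩⟩
  singleton_mem := fun v => ⟨Finset.singleton_nonempty v, fun x hx y hy hxy => by
    rw [Finset.mem_singleton] at hx hy
    exact absurd (hx.trans hy.symm) hxy⟩

open Classical in
/-- The vertex map `e` induces an isomorphism of simplicial complexes from `K` to `L`. -/
def IsComplexIso {V W : Type*} (K : PreAbstractSimplicialComplex V)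
    (L : PreAbstractSimplicialComplex W) (e : V → W) : Prop :=
  Set.InjOn e {v | {v} ∈ K.faces} ∧ K.map e = L

/-- `Δ` is an affine building of type `A₂`: it has a system of subcomplexes, the apartments,
satisfying the axioms of a building, in which every apartment is a copy of the Weyl alcove
complex of type `A₂`. -/
def IsAffineBuildingA2 {W : Type*} (Δ : AbstractSimplicialComplex W) : Prop :=
  ∃ apartments : Set (PreAbstractSimplicialComplex W),
    (∀ S ∈ apartments, S ≤ Δ.toPreAbstractSimplicialComplex ∧
      ∃ e, IsComplexIso alcoveComplexA2.toPreAbstractSimplicialComplex S e) ∧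
    (∀ s ∈ Δ.faces, ∃ S ∈ apartments, s ∈ S.faces) ∧
    (∀ s ∈ Δ.faces, ∀ t ∈ Δ.faces, ∃ S ∈ apartments, s ∈ S.faces ∧ t ∈ S.faces) ∧
    (∀ S ∈ apartments, ∀ S' ∈ apartments, ∀ s t,
      s ∈ S.faces → s ∈ S'.faces → t ∈ S.faces → t ∈ S'.faces →
      ∃ e, IsComplexIso S S' e ∧ (∀ v ∈ s, e v = v) ∧ (∀ v ∈ t, e v = v))

/-! ### Triangulated diskoids -/

/-- A triangulated diskoid (contractible compact piecewise-linear region in the plane, with a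
cell structure whose 2-cells are embedded triangles), up to orientation-preserving
homeomorphism, presented by the rotation system of its plane 1-skeleton.

A dart is an edge with a direction; `src` is its starting vertex and `rev` the opposite dart.
`next a` is the dart after `a` on the boundary of the complementary region of the 1-skeleton to
the left of `a`. The darts in `outer` are those whose left-hand region is the unbounded one, so
`next` on `outer` runs clockwise around the diskoid; every other region is a triangle of the
diskoid. Two edges may have the same endpoints, and an edge may lie in no triangle. -/
structure TriangulatedDiskoid where
  Vertex : Type
  Dart : Type
  [finiteVertex : Finite Vertex]
  [finiteDart : Finite Dart]
  src : Dart → Vertex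
  rev : Dart → Dart
  next : Equiv.Perm Dart
  outer : Set Dart
  rev_rev : ∀ a, rev (rev a) = a
  rev_ne : ∀ a, rev a ≠ a
  src_next : ∀ a, src (next a) = src (rev a)
  /-- The darts that start at a given vertex are permuted cyclically by rotation about it. -/
  rotation : ∀ a b, src a = src b → ∃ k : ℕ, (fun c => next (rev c))^[k] a = b
  nonempty : Nonempty Vertex
  connected : ∀ v w,
    Relation.ReflTransGen (fun x y => ∃ a, src a = x ∧ src (rev a) = y) v w
  next_mem_outer : ∀ a, next a ∈ outer ↔ a ∈ outer
  /-- There is a single outer region. -/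
  outer_nonempty : Nonempty Dart → outer.Nonempty
  outer_cycle : ∀ a ∈ outer, ∀ b ∈ outer, ∃ k : ℕ, next^[k] a = b
  /-- The inner regions are triangles with three distinct vertices. -/
  inner_triangle : ∀ a, a ∉ outer → next (next (next a)) = a
  inner_embedded : ∀ a, a ∉ outer → src a ≠ src (next a)
  /-- The Euler characteristic (vertices minus edges plus triangles) is `1`: together with the
  outer region, the vertices, edges and triangles form a 2-sphere. -/
  euler : (Nat.card Vertex : ℤ)
      - ((Set.range fun a => ({a, rev a} : Set Dart)).ncard : ℤ)
      + (((fun a => ({a, next a, next (next a)} : Set Dart)) '' outerᶜ).ncard : ℤ) = 1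

namespace TriangulatedDiskoid

/-- The end vertex of a dart. -/
def tgt (D : TriangulatedDiskoid) (a : D.Dart) : D.Vertex := D.src (D.rev a)

/-- The triangle to the left of an inner dart, as its set of three darts. -/
def triangle (D : TriangulatedDiskoid) (a : D.Dart) : Set D.Dart :=
  {a, D.next a, D.next (D.next a)}

/-- The set of triangles (2-cells) of the diskoid. -/
def triangles (D : TriangulatedDiskoid) : Set (Set D.Dart) := D.triangle '' D.outerᶜ

/-- The area of a triangulated diskoid: its number of triangles. -/
noncomputable def area (D : TriangulatedDiskoid) : ℕ := D.triangles.ncard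

/-- `D` is of type `A₂`: its edges can be labelled by the two minuscule weights of type `A₂`
(here `true` and `false`, which are dual to each other), where reversing an edge dualizes its
label, such that the three edges around each triangle carry the same label. -/
def IsTypeA2 (D : TriangulatedDiskoid) : Prop :=
  ∃ label : D.Dart → Bool, (∀ a, label (D.rev a) = !label a) ∧
    ∀ a, a ∉ D.outer → label (D.next a) = label a

/-! ### The locally Euclidean metric and the `CAT(0)` condition -/

/-- Representatives of the points of the diskoid: vertices, points of edges (`t = 0` is the
start and `t = 1` is the end of the dart), and points of triangles in barycentric coordinates
with respect to the starting points of `a`, `next a`, `next (next a)`. -/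
inductive Point (D : TriangulatedDiskoid) : Type where
  | vertex (v : D.Vertex) : Point D
  | edge (a : D.Dart) (t : Set.Icc (0 : ℝ) 1) : Point D
  | tri (a : D.Dart) (ha : a ∉ D.outer) (x : stdSimplex ℝ (Fin 3)) : Point D

/-- Pairs of representatives of the same point. -/
inductive Glue (D : TriangulatedDiskoid) : Point D → Point D → Prop where
  | edge_src (a : D.Dart) (t : Set.Icc (0 : ℝ) 1) (h : (t : ℝ) = 0) :
      Glue D (.edge a t) (.vertex (D.src a))
  | edge_rev (a : D.Dart) (s t : Set.Icc (0 : ℝ) 1) (h : (s : ℝ) + t = 1) :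
      Glue D (.edge a s) (.edge (D.rev a) t)
  | tri_edge (a : D.Dart) (ha : a ∉ D.outer) (x : stdSimplex ℝ (Fin 3))
      (t : Set.Icc (0 : ℝ) 1) (h1 : x.1 1 = t) (h2 : x.1 2 = 0) :
      Glue D (.tri a ha x) (.edge a t)
  | tri_next (a : D.Dart) (ha : a ∉ D.outer) (hb : D.next a ∉ D.outer)
      (x y : stdSimplex ℝ (Fin 3))
      (h0 : y.1 0 = x.1 1) (h1 : y.1 1 = x.1 2) (h2 : y.1 2 = x.1 0) :
      Glue D (.tri a ha x) (.tri (D.next a) hb y)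

/-- `Chain p q L`: one gets from `p` to `q` along finitely many straight segments, each within
a closed edge or triangle, of total length `L`. Edges have length `1` and triangles are
equilateral Euclidean triangles, in which the distance of the points with barycentric
coordinates `x` and `y` is `√(∑ (xᵢ - yᵢ)² / 2)`. -/
inductive Chain (D : TriangulatedDiskoid) : Point D → Point D → ℝ → Prop where
  | refl (p : Point D) : Chain D p p 0
  | glue {p q r : Point D} {L : ℝ} (h : Chain D p q L) (g : Glue D q r ∨ Glue D r q) :
      Chain D p r L
  | edge {p : Point D} {L : ℝ} (a : D.Dart) (s t : Set.Icc (0 : ℝ) 1)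
      (h : Chain D p (.edge a s) L) : Chain D p (.edge a t) (L + |(s : ℝ) - t|)
  | tri {p : Point D} {L : ℝ} (a : D.Dart) (ha : a ∉ D.outer) (x y : stdSimplex ℝ (Fin 3))
      (h : Chain D p (.tri a ha x) L) :
      Chain D p (.tri a ha y) (L + Real.sqrt ((∑ i, (x.1 i - y.1 i) ^ 2) / 2))

/-- The locally Euclidean (intrinsic) metric of the diskoid, with equilateral triangles of side
length `1`. Representatives of the same point have distance `0`. -/
noncomputable def intrinsicDist (D : TriangulatedDiskoid) (p q : Point D) : ℝ :=
  sInf {L | Chain D p q L}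

end TriangulatedDiskoid

/-- `γ`, restricted to `[0, 1]`, is a geodesic from `x` to `y` for the (pseudo)metric `d`,
parametrized proportionally to length. -/
def IsGeodesicFor {X : Type*} (d : X → X → ℝ) (γ : ℝ → X) (x y : X) : Prop :=
  γ 0 = x ∧ γ 1 = y ∧ ∀ s ∈ Set.Icc (0 : ℝ) 1, ∀ t ∈ Set.Icc (0 : ℝ) 1,
    d (γ s) (γ t) = |s - t| * d x y

/-- The (pseudo)metric `d` on `X` is `CAT(0)`: any two points are joined by a geodesic, and
geodesic triangles are at least as thin as their comparison triangles in the Euclidean plane.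
(Any two sides of a triangle have a common corner, which is called `x` here.) -/
def IsCAT0Dist {X : Type*} (d : X → X → ℝ) : Prop :=
  (∀ x y, ∃ γ, IsGeodesicFor d γ x y) ∧
  ∀ x y z γ γ', IsGeodesicFor d γ x y → IsGeodesicFor d γ' x z →
    ∀ x' y' z' : EuclideanSpace ℝ (Fin 2),
      dist x' y' = d x y → dist x' z' = d x z → dist y' z' = d y z →
      ∀ s ∈ Set.Icc (0 : ℝ) 1, ∀ t ∈ Set.Icc (0 : ℝ) 1,
        d (γ s) (γ' t) ≤ dist (AffineMap.lineMap x' y' s) (AffineMap.lineMap x' z' t)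

namespace TriangulatedDiskoid

/-- The diskoid is `CAT(0)` in its locally Euclidean metric. -/
def IsCAT0 (D : TriangulatedDiskoid) : Prop := IsCAT0Dist D.intrinsicDist

/-! ### Maps to a simplicial complex -/

open Classical in
/-- The vertices of an edge. -/
noncomputable def edgeVerts (D : TriangulatedDiskoid) (a : D.Dart) : Finset D.Vertex :=
  {D.src a, D.tgt a}

open Classical in
/-- The vertices of the triangle to the left of an inner dart. -/
noncomputable def triVerts (D : TriangulatedDiskoid) (a : D.Dart) : Finset D.Vertex :=
  {D.src a, D.src (D.next a), D.src (D.next (D.next a))}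

open Classical in
/-- `f` is (the vertex map of) a simplicial map: the vertices of each edge and of each triangle
go to the vertices of a simplex, which may have smaller dimension. -/
def IsSimplicialMap {W : Type*} (D : TriangulatedDiskoid) (Δ : AbstractSimplicialComplex W)
    (f : D.Vertex → W) : Prop :=
  (∀ a, (D.edgeVerts a).image f ∈ Δ.faces) ∧
  ∀ a, a ∉ D.outer → (D.triVerts a).image f ∈ Δ.faces

/-- `f` is a simplicial embedding: a simplicial map that is injective on the diskoid. That is,
it is injective on vertices, no edge is a loop (hence collapsed), and different edges and
different triangles have different images. -/
def IsEmbedding {W : Type*} (D : TriangulatedDiskoid) (Δ : AbstractSimplicialComplex W)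
    (f : D.Vertex → W) : Prop :=
  D.IsSimplicialMap Δ f ∧ Function.Injective f ∧ (∀ a, D.src a ≠ D.tgt a) ∧
  (∀ a b, D.edgeVerts a = D.edgeVerts b → b = a ∨ b = D.rev a) ∧
  ∀ a b, a ∉ D.outer → b ∉ D.outer → D.triVerts a = D.triVerts b → D.triangle a = D.triangle b

/-! ### Boundary polygons and isomorphisms -/

/-- An isomorphism between the boundary polygons of two diskoids. The edges of the boundary
polygon of `D` are the outer darts of `D`, cyclically ordered by `next` (an edge of `D` in no
triangle occurs twice). -/
structure BoundaryIso (D' D : TriangulatedDiskoid) where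
  toEquiv : D'.outer ≃ D.outer
  map_next : ∀ a b : D'.outer, (b : D'.Dart) = D'.next a →
    (toEquiv b : D.Dart) = D.next (toEquiv a)

/-- With the boundary polygons of `D'` and `D` identified by `β`, the restrictions of `f'` and
`f` to the polygon agree. (If there are no darts, both diskoids and their polygons are single
points.) -/
def BoundaryIso.Agree {W : Type*} {D' D : TriangulatedDiskoid} (β : BoundaryIso D' D)
    (f' : D'.Vertex → W) (f : D.Vertex → W) : Prop :=
  (∀ a : D'.outer, f' (D'.src a) = f (D.src (β.toEquiv a))) ∧
  (IsEmpty D'.Dart → ∀ v' v, f' v' = f v)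

/-- An (orientation-preserving, cellular) isomorphism of triangulated diskoids. -/
structure Iso (D' D : TriangulatedDiskoid) where
  vertexEquiv : D'.Vertex ≃ D.Vertex
  dartEquiv : D'.Dart ≃ D.Dart
  map_src : ∀ a, D.src (dartEquiv a) = vertexEquiv (D'.src a)
  map_rev : ∀ a, D.rev (dartEquiv a) = dartEquiv (D'.rev a)
  map_next : ∀ a, D.next (dartEquiv a) = dartEquiv (D'.next a)
  map_outer : ∀ a, dartEquiv a ∈ D.outer ↔ a ∈ D'.outer

end TriangulatedDiskoid

/-!
The proof compares the diskoids as `2`-chains in the building. The building has dimension `2` and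
no second homology, so two diskoids with the same boundary polygon have the same image chain. An
embedded diskoid covers each triangle of its image once; hence the other diskoid covers each of
these triangles at least once, and its area is at least as large.

Vanishing of homology is used in a dual, elementary form: every triangle of the building carries
a `1`-cochain whose coboundary is `±1` on this triangle and `0` on all others
(`IsAffineBuildingA2.exists_cochain`). In the plane, such a cochain counts the crossings of an edge
with a ray that starts in the triangle (`IsAlcove.exists_cochain`). It is pulled back to the
building along the retraction onto an apartment centered at the triangle
(`IsAffineBuildingA2.exists_retraction`), which sends no other triangle to this one; the retraction
is well defined because an automorphism of the tiling that fixes a triangle is the identity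
(`IsAlcove.rigid`). Stokes' theorem (`TriangulatedDiskoid.sum_triCoboundary`) shows that the
signed number of times that a diskoid covers the triangle depends only on its boundary.

If the areas agree, each triangle of the embedded diskoid is covered exactly once and with the
right orientation, and there are no other triangles. This matches the darts inside triangles, and
the boundary polygons are matched by hypothesis. As a dart of an embedded diskoid is determined by
the images of its endpoints, the two matchings are compatible with reversal of darts, and together
they are an isomorphism of rotation systems (`TriangulatedDiskoid.IsEmbedding.exists_iso`).
-/

/-! ### The triangular tiling of the plane -/

theorem mem_minusculeA2 {d : ℤ × ℤ} : d ∈ minusculeA2 ↔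
    (d.1 = 1 ∧ d.2 = 0) ∨ (d.1 = -1 ∧ d.2 = 1) ∨ (d.1 = 0 ∧ d.2 = -1) ∨
      (d.1 = 0 ∧ d.2 = 1) ∨ (d.1 = 1 ∧ d.2 = -1) ∨ (d.1 = -1 ∧ d.2 = 0) := by
  simp [minusculeA2, Prod.ext_iff]

/-- Three lattice points span a triangle of the tiling. -/
def IsAlcove (x y z : ℤ × ℤ) : Prop :=
  x - y ∈ minusculeA2 ∧ y - z ∈ minusculeA2 ∧ z - x ∈ minusculeA2

/-- Every edge of the tiling lies in exactly two triangles, which are images of each other under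
the half-turn about the midpoint of the edge. -/
theorem IsAlcove.eq_or_eq_of_adjacent {x y z w : ℤ × ℤ} (h : IsAlcove x y z)
    (hx : w - x ∈ minusculeA2) (hy : w - y ∈ minusculeA2) : w = z ∨ w = x + y - z := by
  obtain ⟨h1, h2, h3⟩ := h
  simp only [mem_minusculeA2, Prod.ext_iff, Prod.fst_sub, Prod.snd_sub, Prod.fst_add,
    Prod.snd_add] at *
  omega

theorem neg_mem_minusculeA2 {d : ℤ × ℤ} (h : d ∈ minusculeA2) : -d ∈ minusculeA2 := by
  simp only [mem_minusculeA2, Prod.fst_neg, Prod.snd_neg] at *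
  omega

theorem sub_mem_minusculeA2_comm {x y : ℤ × ℤ} :
    x - y ∈ minusculeA2 ↔ y - x ∈ minusculeA2 :=
  ⟨fun h => by simpa using neg_mem_minusculeA2 h, fun h => by simpa using neg_mem_minusculeA2 h⟩

theorem IsAlcove.rotate {x y z : ℤ × ℤ} (h : IsAlcove x y z) : IsAlcove y z x :=
  ⟨h.2.1, h.2.2, h.1⟩

theorem IsAlcove.swap {x y z : ℤ × ℤ} (h : IsAlcove x y z) : IsAlcove y x z :=
  ⟨sub_mem_minusculeA2_comm.1 h.1, sub_mem_minusculeA2_comm.1 h.2.2,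
    sub_mem_minusculeA2_comm.1 h.2.1⟩

theorem IsAlcove.reflect {x y z : ℤ × ℤ} (h : IsAlcove x y z) : IsAlcove x y (x + y - z) := by
  refine ⟨h.1, ?_, ?_⟩
  · have : y - (x + y - z) = z - x := by abel
    rw [this]; exact h.2.2
  · have : x + y - z - x = y - z := by abel
    rw [this]; exact h.2.1

/-- The fixed points of an injective simplicial map propagate from a triangle of the tiling to
each neighbouring triangle. -/
theorem IsAlcove.fixed_reflect {g : ℤ × ℤ → ℤ × ℤ} (hinj : Function.Injective g)
    (hg : ∀ x y, x - y ∈ minusculeA2 → g x - g y ∈ minusculeA2) {x y z : ℤ × ℤ}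
    (h : IsAlcove x y z) (hx : g x = x) (hy : g y = y) (hz : g z = z) :
    g (x + y - z) = x + y - z := by
  have h1 := hg _ _ h.reflect.2.2
  have h2 := hg _ _ (sub_mem_minusculeA2_comm.1 h.reflect.2.1)
  rw [hx] at h1
  rw [hy] at h2
  -- By injectivity, the image of the reflected vertex is not `z = g z`.
  refine (h.eq_or_eq_of_adjacent h1 h2).resolve_left fun h3 => ?_
  have h4 : x + y - z = z := hinj (h3.trans hz.symm)
  have h5 := h.2.1
  have h6 := h.2.2
  have h7 := h.1
  simp only [mem_minusculeA2, Prod.ext_iff, Prod.fst_sub, Prod.snd_sub, Prod.fst_add,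
    Prod.snd_add] at *
  omega

theorem det_mul_det_of_mem_minusculeA2 {a b : ℤ × ℤ} (ha : a ∈ minusculeA2)
    (hb : b ∈ minusculeA2) (hab : a - b ∈ minusculeA2) :
    (a.1 * b.2 - a.2 * b.1) * (a.1 * b.2 - a.2 * b.1) = 1 := by
  obtain ⟨a1, a2⟩ := a
  obtain ⟨b1, b2⟩ := b
  simp only [mem_minusculeA2, Prod.fst_sub, Prod.snd_sub] at *
  rcases ha with ⟨rfl, rfl⟩ | ⟨rfl, rfl⟩ | ⟨rfl, rfl⟩ | ⟨rfl, rfl⟩ | ⟨rfl, rfl⟩ | ⟨rfl, rfl⟩ <;>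
  rcases hb with ⟨rfl, rfl⟩ | ⟨rfl, rfl⟩ | ⟨rfl, rfl⟩ | ⟨rfl, rfl⟩ | ⟨rfl, rfl⟩ | ⟨rfl, rfl⟩ <;>
  revert hab <;> decide

theorem IsAlcove.exists_coords {x y z : ℤ × ℤ} (h : IsAlcove x y z) (p : ℤ × ℤ) :
    ∃ m n : ℤ, p = z + m • (x - z) + n • (y - z) := by
  obtain ⟨h1, h2, h3⟩ := h
  -- The edge vectors at `z` have determinant `±1`, and this is Cramer's rule.
  let a := x - z
  let b := y - z
  let q := p - z
  let δ := a.1 * b.2 - a.2 * b.1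
  refine ⟨δ * (q.1 * b.2 - q.2 * b.1), δ * (a.1 * q.2 - a.2 * q.1), ?_⟩
  have hδ : δ * δ = 1 :=
    det_mul_det_of_mem_minusculeA2 (sub_mem_minusculeA2_comm.1 h3) h2 (by simpa [a, b] using h1)
  have hp : p = z + q := by simp [q]
  rw [hp, add_assoc, add_right_inj]
  change q = _ • a + _ • b
  ext
  · simp only [Prod.fst_add, Prod.smul_fst, smul_eq_mul]
    linear_combination (-q.1) * hδ
  · simp only [Prod.snd_add, Prod.smul_snd, smul_eq_mul]
    linear_combination (-q.2) * hδ

/-- Rigidity of the tiling: an injective simplicial map that fixes the vertices of one triangle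
is the identity. -/
theorem IsAlcove.rigid {g : ℤ × ℤ → ℤ × ℤ} (hinj : Function.Injective g)
    (hg : ∀ x y, x - y ∈ minusculeA2 → g x - g y ∈ minusculeA2) {x y z : ℤ × ℤ}
    (h : IsAlcove x y z) (hx : g x = x) (hy : g y = y) (hz : g z = z) (p : ℤ × ℤ) :
    g p = p := by
  -- The fixed triangles among the translates of `x y z`.
  let F : ℤ × ℤ → Prop := fun t => g (t + x) = t + x ∧ g (t + y) = t + y ∧ g (t + z) = t + z
  have htr : ∀ t, IsAlcove (t + x) (t + y) (t + z) := fun t => by simpa [IsAlcove] using h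
  -- Two reflections move a triangle by an edge vector.
  have key : ∀ t u v w, IsAlcove u v w → g (t + u) = t + u → g (t + v) = t + v →
      g (t + w) = t + w → g (t + (u - w) + u) = t + (u - w) + u ∧
      g (t + (u - w) + v) = t + (u - w) + v ∧ g (t + (u - w) + w) = t + (u - w) + w := by
    intro t u v w hT hu hv hw
    have hT' : IsAlcove (t + u) (t + v) (t + w) := by simpa [IsAlcove] using hT
    have e1 := hT'.fixed_reflect hinj hg hu hv hw
    have e2 := hT'.reflect.rotate.rotate.swap.fixed_reflect hinj hg hu e1 hv
    have r1 : t + u + (t + v) - (t + w) = t + (u - w) + v := by abel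
    have r2 : t + u + (t + u + (t + v) - (t + w)) - (t + v) = t + (u - w) + u := by abel
    have r3 : t + (u - w) + w = t + u := by abel
    rw [r1] at e1
    rw [r2] at e2
    rw [r3]
    exact ⟨e2, e1, hu⟩
  have s1 : ∀ t, F t → F (t + (x - z)) := fun t ⟨a, b, c⟩ => key t x y z h a b c
  have s2 : ∀ t, F t → F (t - (x - z)) := fun t ⟨a, b, c⟩ => by
    have := key t z y x h.rotate.swap c b a
    rw [show t + (z - x) = t - (x - z) by abel] at this
    exact ⟨this.2.2, this.2.1, this.1⟩
  have s3 : ∀ t, F t → F (t + (y - z)) := fun t ⟨a, b, c⟩ => by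
    have := key t y x z h.swap b a c
    exact ⟨this.2.1, this.1, this.2.2⟩
  have s4 : ∀ t, F t → F (t - (y - z)) := fun t ⟨a, b, c⟩ => by
    have := key t z x y h.rotate.rotate c a b
    rw [show t + (z - y) = t - (y - z) by abel] at this
    exact ⟨this.2.1, this.2.2, this.1⟩
  have hm : ∀ m : ℤ, F (m • (x - z)) := fun m => by
    induction m using Int.induction_on with
    | zero => simpa [F] using ⟨hx, hy, hz⟩
    | succ i ih => rw [add_smul, one_smul]; exact s1 _ ih
    | pred i ih => rw [sub_smul, one_smul]; exact s2 _ ih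
  have hmn : ∀ m n : ℤ, F (m • (x - z) + n • (y - z)) := fun m n => by
    induction n using Int.induction_on with
    | zero => simpa using hm m
    | succ i ih => rw [add_smul, one_smul, ← add_assoc]; exact s3 _ ih
    | pred i ih => rw [sub_smul, one_smul, ← add_sub_assoc]; exact s4 _ ih
  obtain ⟨m, n, rfl⟩ := h.exists_coords p
  have := (hmn m n).2.2
  rwa [show m • (x - z) + n • (y - z) + z = z + m • (x - z) + n • (y - z) by abel] at this

/-- Up to the order of its vertices, a triangle of the tiling is the lower or the upper half of a
lattice parallelogram. -/
@[elab_as_elim]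
theorem IsAlcove.induction {P : ℤ × ℤ → ℤ × ℤ → ℤ × ℤ → Prop}
    (rotate : ∀ x y z, P x y z → P y z x) (swap : ∀ x y z, P x y z → P y x z)
    (lower : ∀ a b, P (a, b) (a + 1, b) (a, b + 1))
    (upper : ∀ a b, P (a + 1, b + 1) (a, b + 1) (a + 1, b)) {x y z : ℤ × ℤ}
    (h : IsAlcove x y z) : P x y z := by
  have lower' : ∀ x y z : ℤ × ℤ, y.1 = x.1 + 1 ∧ y.2 = x.2 ∧ z.1 = x.1 ∧ z.2 = x.2 + 1 →
      P x y z := by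
    rintro ⟨x1, x2⟩ ⟨y1, y2⟩ ⟨z1, z2⟩ ⟨h1, h2, h3, h4⟩
    simp only at h1 h2 h3 h4
    subst h1 h2 h3 h4
    exact lower _ _
  have upper' : ∀ x y z : ℤ × ℤ, x.1 = y.1 + 1 ∧ x.2 = y.2 ∧ z.1 = x.1 ∧ y.2 = z.2 + 1 →
      P x y z := by
    rintro ⟨x1, x2⟩ ⟨y1, y2⟩ ⟨z1, z2⟩ ⟨h1, h2, h3, h4⟩
    simp only at h1 h2 h3 h4
    subst h1 h2 h3 h4
    exact upper _ _
  obtain ⟨hxy, hyz, hzx⟩ := h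
  simp only [mem_minusculeA2, Prod.fst_sub, Prod.snd_sub] at hxy hyz hzx
  rcases hxy with hxy | hxy | hxy | hxy | hxy | hxy <;>
  rcases hzx with hzx | hzx | hzx | hzx | hzx | hzx <;>
  first
    | (exfalso; omega)
    | exact lower' _ _ _ (by omega)
    | exact rotate _ _ _ (lower' _ _ _ (by omega))
    | exact rotate _ _ _ (rotate _ _ _ (lower' _ _ _ (by omega)))
    | exact swap _ _ _ (lower' _ _ _ (by omega))
    | exact swap _ _ _ (rotate _ _ _ (lower' _ _ _ (by omega)))
    | exact swap _ _ _ (rotate _ _ _ (rotate _ _ _ (lower' _ _ _ (by omega))))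
    | exact upper' _ _ _ (by omega)
    | exact rotate _ _ _ (upper' _ _ _ (by omega))
    | exact rotate _ _ _ (rotate _ _ _ (upper' _ _ _ (by omega)))
    | exact swap _ _ _ (upper' _ _ _ (by omega))
    | exact swap _ _ _ (rotate _ _ _ (upper' _ _ _ (by omega)))
    | exact swap _ _ _ (rotate _ _ _ (rotate _ _ _ (upper' _ _ _ (by omega))))

/-! ### A cochain bounding a single triangle of the plane -/

/-- The coboundary of the `1`-cochain `ψ`, evaluated on an oriented triangle. -/
def coboundary {V : Type*} (ψ : V → V → ℤ) (x y z : V) : ℤ := ψ x y + ψ y z + ψ z x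

section coboundary

variable {V : Type*} {ψ : V → V → ℤ}

theorem coboundary_rotate (ψ : V → V → ℤ) (x y z : V) :
    coboundary ψ y z x = coboundary ψ x y z := by
  simp only [coboundary]; ring

theorem coboundary_swap (hψ : ∀ x y, ψ x y = -ψ y x) (x y z : V) :
    coboundary ψ y x z = -coboundary ψ x y z := by
  simp only [coboundary]; rw [hψ y x, hψ x z, hψ z y]; ring

theorem coboundary_self (hψ : ∀ x y, ψ x y = -ψ y x) (x z : V) : coboundary ψ x x z = 0 := by
  have := coboundary_swap hψ x x z
  omega

end coboundary

/-- The `1`-cochain counting how often an edge crosses, upwards or downwards, the horizontal ray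
that runs to the right in the strip between the heights `b` and `b + 1`, and first meets the edge
whose endpoints have abscissas adding up to `k`. -/
def rayCrossing (b k : ℤ) (x y : ℤ × ℤ) : ℤ :=
  (if x.2 = b ∧ y.2 = b + 1 ∧ k ≤ x.1 + y.1 then 1 else 0) -
    (if y.2 = b ∧ x.2 = b + 1 ∧ k ≤ x.1 + y.1 then 1 else 0)

theorem rayCrossing_antisymm (b k : ℤ) (x y : ℤ × ℤ) :
    rayCrossing b k x y = -rayCrossing b k y x := by
  simp only [rayCrossing, add_comm x.1]
  ring

/-- The height of the lower side of the horizontal strip that contains the triangle `x y z`. -/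
def alcoveHeight (x y z : ℤ × ℤ) : ℤ := min x.2 (min y.2 z.2)

/-- The place of the triangle `x y z` in its horizontal strip: the sum of the abscissas of the
endpoints of the right one of the two edges that cross the strip. -/
def alcovePlace (x y z : ℤ × ℤ) : ℤ := x.1 + y.1 + z.1 - min x.1 (min y.1 z.1)

theorem alcoveHeight_rotate (x y z : ℤ × ℤ) : alcoveHeight y z x = alcoveHeight x y z := by
  simp only [alcoveHeight]; omega

theorem alcoveHeight_swap (x y z : ℤ × ℤ) : alcoveHeight y x z = alcoveHeight x y z := by
  simp only [alcoveHeight]; omega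

theorem alcovePlace_rotate (x y z : ℤ × ℤ) : alcovePlace y z x = alcovePlace x y z := by
  simp only [alcovePlace]; omega

theorem alcovePlace_swap (x y z : ℤ × ℤ) : alcovePlace y x z = alcovePlace x y z := by
  simp only [alcovePlace]; omega

/-- The coboundary of `rayCrossing b k` vanishes away from the triangle in which the ray
starts. -/
theorem IsAlcove.eq_of_coboundary_rayCrossing_ne_zero {b k : ℤ} {x y z : ℤ × ℤ}
    (h : IsAlcove x y z) (h0 : coboundary (rayCrossing b k) x y z ≠ 0) :
    b = alcoveHeight x y z ∧ k = alcovePlace x y z := by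
  revert h0
  refine IsAlcove.induction ?rotate ?swap ?lower ?upper h
  case rotate =>
    intro x y z ih
    rwa [coboundary_rotate, alcoveHeight_rotate, alcovePlace_rotate]
  case swap =>
    intro x y z ih
    rwa [coboundary_swap (rayCrossing_antisymm b k), neg_ne_zero, alcoveHeight_swap,
      alcovePlace_swap]
  case lower =>
    intro a c h0
    simp only [coboundary, rayCrossing, alcoveHeight, alcovePlace] at h0 ⊢
    by_cases hc : c = b
    · subst hc
      simp at h0 ⊢
      split_ifs at h0 <;> omega
    · simp [hc] at h0
      split_ifs at h0 <;> omega
  case upper =>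
    intro a c h0
    simp only [coboundary, rayCrossing, alcoveHeight, alcovePlace] at h0 ⊢
    by_cases hc : c = b
    · subst hc
      simp at h0 ⊢
      split_ifs at h0 <;> omega
    · simp [hc] at h0
      split_ifs at h0 <;> omega

theorem IsAlcove.coboundary_rayCrossing_self {x y z : ℤ × ℤ} (h : IsAlcove x y z) :
    |coboundary (rayCrossing (alcoveHeight x y z) (alcovePlace x y z)) x y z| = 1 := by
  refine IsAlcove.induction ?rotate ?swap ?lower ?upper h
  case rotate =>
    intro x y z ih
    rwa [coboundary_rotate, alcoveHeight_rotate, alcovePlace_rotate]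
  case swap =>
    intro x y z ih
    rwa [coboundary_swap (rayCrossing_antisymm _ _), abs_neg, alcoveHeight_swap,
      alcovePlace_swap]
  case lower =>
    intro a b
    have h1 : alcovePlace (a, b) (a + 1, b) (a, b + 1) = 2 * a + 1 := by
      simp only [alcovePlace]; omega
    have h2 : alcoveHeight (a, b) (a + 1, b) (a, b + 1) = b := by
      simp only [alcoveHeight]; omega
    rw [h1, h2]
    simp only [coboundary, rayCrossing, true_and]
    split_ifs <;> first | (exfalso; omega) | simp
  case upper =>
    intro a b
    have h1 : alcovePlace (a + 1, b + 1) (a, b + 1) (a + 1, b) = 2 * a + 2 := by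
      simp only [alcovePlace]; omega
    have h2 : alcoveHeight (a + 1, b + 1) (a, b + 1) (a + 1, b) = b := by
      simp only [alcoveHeight]; omega
    rw [h1, h2]
    simp only [coboundary, rayCrossing, true_and]
    split_ifs <;> first | (exfalso; omega) | simp

theorem triple_rotate {V : Type*} (x y z : V) : ({y, z, x} : Set V) = {x, y, z} := by
  rw [Set.pair_comm z x, Set.insert_comm]

theorem triple_swap {V : Type*} (x y z : V) : ({y, x, z} : Set V) = {x, y, z} :=
  Set.insert_comm _ _ _

/-- A triangle of the tiling is determined by the strip it lies in and its place there. -/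
theorem IsAlcove.eq_of_height_eq_of_place_eq {x y z p q r : ℤ × ℤ} (h : IsAlcove x y z)
    (h' : IsAlcove p q r) (hb : alcoveHeight x y z = alcoveHeight p q r)
    (hk : alcovePlace x y z = alcovePlace p q r) :
    ({x, y, z} : Set (ℤ × ℤ)) = {p, q, r} := by
  revert hb hk
  refine IsAlcove.induction ?rotate ?swap ?lower ?upper h
  case rotate =>
    intro x y z
    rw [alcoveHeight_rotate x y z, alcovePlace_rotate x y z, triple_rotate x y z]
    exact id
  case swap =>
    intro x y z
    rw [alcoveHeight_swap, alcovePlace_swap, triple_swap x y z]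
    exact id
  all_goals
    intro a b
    refine IsAlcove.induction ?_ ?_ ?_ ?_ h'
    · intro p q r
      rw [alcoveHeight_rotate p q r, alcovePlace_rotate p q r, triple_rotate p q r]
      exact id
    · intro p q r
      rw [alcoveHeight_swap p q r, alcovePlace_swap p q r, triple_swap p q r]
      exact id
    all_goals
      intro c d hb hk
      simp only [alcoveHeight, alcovePlace] at hb hk
      first
        | (exfalso; omega)
        | (obtain rfl : a = c := by omega
           obtain rfl : b = d := by omega
           rfl)

/-- On each triangle `p q r` of the tiling there is a `1`-cochain whose coboundary is the
generator `±1` on that triangle and vanishes on all other triangles. -/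
theorem IsAlcove.exists_cochain {p q r : ℤ × ℤ} (h : IsAlcove p q r) :
    ∃ ψ : ℤ × ℤ → ℤ × ℤ → ℤ, (∀ x y, ψ x y = -ψ y x) ∧ |coboundary ψ p q r| = 1 ∧
      ∀ x y z, IsAlcove x y z → coboundary ψ x y z ≠ 0 →
        ({x, y, z} : Set (ℤ × ℤ)) = {p, q, r} := by
  refine ⟨_, rayCrossing_antisymm _ _, h.coboundary_rayCrossing_self, fun x y z hx h0 => ?_⟩
  have := hx.eq_of_coboundary_rayCrossing_ne_zero h0
  exact hx.eq_of_height_eq_of_place_eq h this.1.symm this.2.symm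

/-! ### Retractions of the building onto the plane -/

section IsComplexIso

variable {U V W : Type*}

theorem IsComplexIso.comp {K : PreAbstractSimplicialComplex U} {L : PreAbstractSimplicialComplex V}
    {M : PreAbstractSimplicialComplex W} {u : U → V} {v : V → W} (hv : IsComplexIso L M v)
    (hu : IsComplexIso K L u) : IsComplexIso K M (v ∘ u) := by
  classical
  obtain ⟨hv1, rfl⟩ := hv
  obtain ⟨hu1, rfl⟩ := hu
  refine ⟨?_, ?_⟩
  · intro x hx y hy hxy
    refine hu1 hx hy (hv1 ?_ ?_ hxy)
    · exact ⟨{x}, hx, Finset.image_singleton _ _⟩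
    · exact ⟨{y}, hy, Finset.image_singleton _ _⟩
  · ext s
    simp only [PreAbstractSimplicialComplex.map, Set.mem_image, exists_exists_and_eq_and,
      Finset.image_image]

end IsComplexIso

theorem mem_alcoveComplexA2 {s : Finset (ℤ × ℤ)} : s ∈ alcoveComplexA2.faces ↔
    s.Nonempty ∧ ∀ x ∈ s, ∀ y ∈ s, x ≠ y → x - y ∈ minusculeA2 := Iff.rfl

section Chart

variable {W : Type*} {S : PreAbstractSimplicialComplex W} {u v : ℤ × ℤ → W}

theorem IsComplexIso.injective
    (hu : IsComplexIso alcoveComplexA2.toPreAbstractSimplicialComplex S u) :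
    Function.Injective u := fun _ _ h =>
  hu.1 (alcoveComplexA2.singleton_mem _) (alcoveComplexA2.singleton_mem _) h

open Classical in
theorem IsComplexIso.mem_faces_iff
    (hu : IsComplexIso alcoveComplexA2.toPreAbstractSimplicialComplex S u) {s : Finset W} :
    s ∈ S.faces ↔ ∃ t ∈ alcoveComplexA2.faces, t.image u = s := by
  obtain ⟨_, rfl⟩ := hu
  exact Iff.rfl

open Classical in
theorem IsComplexIso.image_mem_faces_iff
    (hu : IsComplexIso alcoveComplexA2.toPreAbstractSimplicialComplex S u)
    {t : Finset (ℤ × ℤ)} : t.image u ∈ S.faces ↔ t ∈ alcoveComplexA2.faces := by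
  rw [hu.mem_faces_iff]
  refine ⟨?_, fun h => ⟨t, h, rfl⟩⟩
  rintro ⟨t', ht', h⟩
  rwa [← Finset.image_injective hu.injective h]

open Classical in
theorem sub_mem_minusculeA2_iff {x y : ℤ × ℤ} :
    x - y ∈ minusculeA2 ↔ x ≠ y ∧ {x, y} ∈ alcoveComplexA2.faces := by
  rw [mem_alcoveComplexA2]
  constructor
  · intro h
    refine ⟨?_, Finset.insert_nonempty _ _, ?_⟩
    · rintro rfl
      simp [mem_minusculeA2] at h
    · intro a ha b hb hab
      simp only [Finset.mem_insert, Finset.mem_singleton] at ha hb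
      rcases ha with rfl | rfl <;> rcases hb with rfl | rfl
      · exact absurd rfl hab
      · exact h
      · exact sub_mem_minusculeA2_comm.1 h
      · exact absurd rfl hab
  · rintro ⟨hne, _, h⟩
    exact h x (by simp) y (by simp) hne

/-- Two isomorphisms from the tiling to the same apartment agree if they agree on one triangle. -/
theorem IsComplexIso.eq_of_eqOn_alcove
    (hu : IsComplexIso alcoveComplexA2.toPreAbstractSimplicialComplex S u)
    (hv : IsComplexIso alcoveComplexA2.toPreAbstractSimplicialComplex S v) {x y z : ℤ × ℤ}
    (h : IsAlcove x y z) (hx : u x = v x) (hy : u y = v y) (hz : u z = v z) : u = v := by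
  classical
  have hex : ∀ p, ∃ q, v q = u p := fun p => by
    have : ({p} : Finset (ℤ × ℤ)).image u ∈ S.faces :=
      hu.image_mem_faces_iff.2 (alcoveComplexA2.singleton_mem p)
    obtain ⟨t, -, ht⟩ := hv.mem_faces_iff.1 this
    have hp : u p ∈ t.image v := by rw [ht]; simp
    obtain ⟨q, -, hq⟩ := Finset.mem_image.1 hp
    exact ⟨q, hq⟩
  choose g hg using hex
  have hinj : Function.Injective g := fun p q hpq =>
    hu.injective (by rw [← hg p, ← hg q, hpq])
  have hadj : ∀ p q, p - q ∈ minusculeA2 → g p - g q ∈ minusculeA2 := by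
    intro p q hpq
    rw [sub_mem_minusculeA2_iff] at hpq ⊢
    refine ⟨hinj.ne hpq.1, ?_⟩
    rw [← hv.image_mem_faces_iff]
    have : ({g p, g q} : Finset (ℤ × ℤ)).image v = ({p, q} : Finset (ℤ × ℤ)).image u := by
      simp [Finset.image_insert, hg]
    rw [this, hu.image_mem_faces_iff]
    exact hpq.2
  have hfix : ∀ p, u p = v p → g p = p := fun p hp => hv.injective ((hg p).trans hp)
  funext p
  rw [← hg p, h.rigid hinj hadj (hfix _ hx) (hfix _ hy) (hfix _ hz) p]

end Chart

section Retraction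

variable {W : Type*} {Δ : AbstractSimplicialComplex W}

/-- The retraction of the building onto an apartment, centered at the triangle `c₀ c₁ c₂` and
read in coordinates of the apartment: on each simplex it is inverse to a simplicial isomorphism
from the tiling to an apartment, and all these isomorphisms agree on the triangle `p q r` that
they send to `c₀ c₁ c₂`. (The face spanned by `c₀ c₁ c₂` is described by its elements, so that
no decidable equality on `W` enters the statement.) -/
theorem IsAffineBuildingA2.exists_retraction (hΔ : IsAffineBuildingA2 Δ) {c₀ c₁ c₂ : W}
    (hc : ∀ s : Finset W, (∀ w, w ∈ s ↔ w = c₀ ∨ w = c₁ ∨ w = c₂) → s ∈ Δ.faces)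
    (h01 : c₀ ≠ c₁) (h12 : c₁ ≠ c₂) (h20 : c₂ ≠ c₀) :
    ∃ (ρ : W → ℤ × ℤ) (p q r : ℤ × ℤ), IsAlcove p q r ∧ ∀ s ∈ Δ.faces,
      ∃ (S : PreAbstractSimplicialComplex W) (u : ℤ × ℤ → W),
        IsComplexIso alcoveComplexA2.toPreAbstractSimplicialComplex S u ∧
        s ∈ S.faces ∧ u p = c₀ ∧ u q = c₁ ∧ u r = c₂ ∧ ∀ w ∈ s, u (ρ w) = w := by
  classical
  obtain ⟨apts, hapt, hcov, hpair, hiso⟩ := hΔ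
  let C : Finset W := {c₀, c₁, c₂}
  have hC : C ∈ Δ.faces := hc C fun w => by simp [C]
  obtain ⟨A, hA, hCA⟩ := hcov C hC
  obtain ⟨a, ha⟩ := (hapt A hA).2
  obtain ⟨T, hT, hTC⟩ := ha.mem_faces_iff.1 hCA
  have hex : ∀ w ∈ C, ∃ p ∈ T, a p = w := fun w hw => by
    rw [← hTC] at hw
    exact Finset.mem_image.1 hw
  obtain ⟨p, hpT, hp⟩ := hex c₀ (by simp [C])
  obtain ⟨q, hqT, hq⟩ := hex c₁ (by simp [C])
  obtain ⟨r, hrT, hr⟩ := hex c₂ (by simp [C])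
  have hpqr : IsAlcove p q r := by
    refine ⟨hT.2 p hpT q hqT ?_, hT.2 q hqT r hrT ?_, hT.2 r hrT p hpT ?_⟩
    · rintro rfl; exact h01 (hp.symm.trans hq)
    · rintro rfl; exact h12 (hq.symm.trans hr)
    · rintro rfl; exact h20 (hr.symm.trans hp)
  -- The charts of the apartments through `C` that are adapted to `C`.
  let Chart : PreAbstractSimplicialComplex W → (ℤ × ℤ → W) → Prop := fun S u =>
    S ∈ apts ∧ C ∈ S.faces ∧ IsComplexIso alcoveComplexA2.toPreAbstractSimplicialComplex S u ∧
      u p = c₀ ∧ u q = c₁ ∧ u r = c₂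
  have hchart : ∀ s ∈ Δ.faces, ∃ S u, Chart S u ∧ s ∈ S.faces := fun s hs => by
    obtain ⟨S, hS, hCS, hsS⟩ := hpair C hC s hs
    obtain ⟨g, hg, hgC, -⟩ := hiso A hA S hS C C hCA hCS hCA hCS
    refine ⟨S, g ∘ a, ⟨hS, hCS, hg.comp ha, ?_, ?_, ?_⟩, hsS⟩
    · simp only [Function.comp_apply, hp]; exact hgC _ (by simp [C])
    · simp only [Function.comp_apply, hq]; exact hgC _ (by simp [C])
    · simp only [Function.comp_apply, hr]; exact hgC _ (by simp [C])
  -- A vertex has the same coordinates in all these charts.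
  have huniq : ∀ S u S' u' x x', Chart S u → Chart S' u' → u x = u' x' → x = x' := by
    rintro S u S' u' x x' ⟨hS, hCS, hu, hup, huq, hur⟩ ⟨hS', hCS', hu', hup', huq', hur'⟩ hx
    have hxS : {u x} ∈ S.faces := by
      rw [← Finset.image_singleton, hu.image_mem_faces_iff]
      exact alcoveComplexA2.singleton_mem x
    have hxS' : {u x} ∈ S'.faces := by
      rw [hx, ← Finset.image_singleton, hu'.image_mem_faces_iff]
      exact alcoveComplexA2.singleton_mem x'
    obtain ⟨g, hg, hgC, hgx⟩ := hiso S hS S' hS' C {u x} hCS hCS' hxS hxS'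
    have hgu : g ∘ u = u' := by
      refine (hg.comp hu).eq_of_eqOn_alcove hu' hpqr ?_ ?_ ?_
      · simp only [Function.comp_apply, hup, hup']; exact hgC _ (by simp [C])
      · simp only [Function.comp_apply, huq, huq']; exact hgC _ (by simp [C])
      · simp only [Function.comp_apply, hur, hur']; exact hgC _ (by simp [C])
    refine hu'.injective ?_
    rw [← hx, ← hgu]
    exact hgx _ (Finset.mem_singleton_self _)
  have hcoord : ∀ w, ∃ x, ∃ S u, Chart S u ∧ u x = w := fun w => by
    obtain ⟨S, u, hSu, hw⟩ := hchart {w} (Δ.singleton_mem w)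
    obtain ⟨t, -, ht⟩ := hSu.2.2.1.mem_faces_iff.1 hw
    obtain ⟨x, -, hx⟩ := Finset.mem_image.1 (ht.symm ▸ Finset.mem_singleton_self w)
    exact ⟨x, S, u, hSu, hx⟩
  choose ρ hρ using hcoord
  refine ⟨ρ, p, q, r, hpqr, fun s hs => ?_⟩
  obtain ⟨S, u, hSu, hsS⟩ := hchart s hs
  refine ⟨S, u, hSu.2.2.1, hsS, hSu.2.2.2.1, hSu.2.2.2.2.1, hSu.2.2.2.2.2, fun w hw => ?_⟩
  obtain ⟨t, -, rfl⟩ := hSu.2.2.1.mem_faces_iff.1 hsS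
  obtain ⟨x, -, rfl⟩ := Finset.mem_image.1 hw
  obtain ⟨S', u', hSu', hx⟩ := hρ (u x)
  rw [huniq _ _ _ _ _ _ hSu' hSu hx]

/-- Every triangle `c₀ c₁ c₂` of the building carries a `1`-cochain whose coboundary is `±1` on
it and vanishes on all other, possibly degenerate, triangles. It is the pullback along the
retraction centered at `c₀ c₁ c₂` of such a cochain of the plane, since the retraction sends no
other triangle to the image of `c₀ c₁ c₂`. -/
theorem IsAffineBuildingA2.exists_cochain (hΔ : IsAffineBuildingA2 Δ) {c₀ c₁ c₂ : W}
    (hc : ∀ s : Finset W, (∀ w, w ∈ s ↔ w = c₀ ∨ w = c₁ ∨ w = c₂) → s ∈ Δ.faces)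
    (h01 : c₀ ≠ c₁) (h12 : c₁ ≠ c₂) (h20 : c₂ ≠ c₀) :
    ∃ ψ : W → W → ℤ, (∀ x y, ψ x y = -ψ y x) ∧ |coboundary ψ c₀ c₁ c₂| = 1 ∧
      ∀ s ∈ Δ.faces, ∀ x ∈ s, ∀ y ∈ s, ∀ z ∈ s, coboundary ψ x y z ≠ 0 →
        ({x, y, z} : Set W) = {c₀, c₁, c₂} := by
  classical
  obtain ⟨ρ, p, q, r, hpqr, hρ⟩ := hΔ.exists_retraction hc h01 h12 h20
  obtain ⟨ψ, hanti, hone, hzero⟩ := hpqr.exists_cochain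
  refine ⟨fun x y => ψ (ρ x) (ρ y), fun x y => hanti _ _, ?_, ?_⟩
  · obtain ⟨S, u, hu, -, hup, huq, hur, hv⟩ := hρ {c₀, c₁, c₂} (hc _ (by simp))
    have h0 : ρ c₀ = p := hu.injective ((hv c₀ (by simp)).trans hup.symm)
    have h1 : ρ c₁ = q := hu.injective ((hv c₁ (by simp)).trans huq.symm)
    have h2 : ρ c₂ = r := hu.injective ((hv c₂ (by simp)).trans hur.symm)
    rw [← hone, ← h0, ← h1, ← h2]
    rfl
  · intro s hs x hx y hy z hz hne
    obtain ⟨S, u, hu, hsS, hup, huq, hur, hv⟩ := hρ s hs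
    replace hne : coboundary ψ (ρ x) (ρ y) (ρ z) ≠ 0 := hne
    have hadj : ∀ a ∈ s, ∀ b ∈ s, ρ a ≠ ρ b → ρ a - ρ b ∈ minusculeA2 := fun a ha b hb hab => by
      have : s.image ρ ∈ alcoveComplexA2.faces := by
        rw [← hu.image_mem_faces_iff, Finset.image_image]
        convert hsS
        exact (Finset.image_congr fun w hw => hv w hw).trans Finset.image_id
      exact this.2 _ (Finset.mem_image_of_mem _ ha) _ (Finset.mem_image_of_mem _ hb) hab
    have hxy : ρ x ≠ ρ y := fun h => hne (by rw [h]; exact coboundary_self hanti _ _)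
    have hyz : ρ y ≠ ρ z := fun h => hne (by
      rw [h, ← coboundary_rotate]; exact coboundary_self hanti _ _)
    have hzx : ρ z ≠ ρ x := fun h => hne (by
      rw [h, ← coboundary_rotate, ← coboundary_rotate]; exact coboundary_self hanti _ _)
    have := hzero _ _ _ ⟨hadj x hx y hy hxy, hadj y hy z hz hyz, hadj z hz x hx hzx⟩ hne
    replace this := congrArg (u '' ·) this
    simpa only [Set.image_insert_eq, Set.image_singleton, hv x hx, hv y hy, hv z hz, hup, huq,
      hur] using this

end Retraction

/-! ### Counting triangles by coboundaries -/

theorem coboundary_eq_zero_or_eq_or_eq_neg {V : Type*} {ψ : V → V → ℤ}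
    (hψ : ∀ x y, ψ x y = -ψ y x) {x y z p q r : V}
    (h : ({x, y, z} : Set V) = {p, q, r}) :
    coboundary ψ x y z = 0 ∨ (x = p ∧ y = q ∧ z = r) ∨ (x = q ∧ y = r ∧ z = p) ∨
      (x = r ∧ y = p ∧ z = q) ∨ coboundary ψ x y z = -coboundary ψ p q r := by
  have h0 : ∀ v, ψ v v = 0 := fun v => by have := hψ v v; omega
  have hx : x ∈ ({p, q, r} : Set V) := by rw [← h]; simp
  have hy : y ∈ ({p, q, r} : Set V) := by rw [← h]; simp
  have hz : z ∈ ({p, q, r} : Set V) := by rw [← h]; simp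
  have e1 := hψ p q
  have e2 := hψ q r
  have e3 := hψ r p
  simp only [Set.mem_insert_iff, Set.mem_singleton_iff] at hx hy hz
  simp only [coboundary]
  rcases hx with rfl | rfl | rfl <;> rcases hy with rfl | rfl | rfl <;>
    rcases hz with rfl | rfl | rfl <;> first | (simp; done) | (simp only [h0]; omega)

/-- Comparison of two finite families fibre by fibre. -/
theorem card_le_card_of_fiber_le {α β γ : Type*} [DecidableEq γ] (s : Finset α) (t : Finset β)
    (τ : α → γ) (τ' : β → γ)
    (h : ∀ a ∈ s, (s.filter fun x => τ x = τ a).card ≤ (t.filter fun y => τ' y = τ a).card) :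
    s.card ≤ t.card ∧ (t.card = s.card →
      (∀ a ∈ s, (t.filter fun y => τ' y = τ a).card = (s.filter fun x => τ x = τ a).card) ∧
      ∀ b ∈ t, ∃ a ∈ s, τ a = τ' b) := by
  classical
  set t₀ := t.filter fun y => τ' y ∈ s.image τ with ht₀
  have hs : s.card = ∑ c ∈ s.image τ, (s.filter fun x => τ x = c).card :=
    Finset.card_eq_sum_card_image τ s
  have ht : t₀.card = ∑ c ∈ s.image τ, (t₀.filter fun y => τ' y = c).card :=
    Finset.card_eq_sum_card_fiberwise fun y hy => (Finset.mem_filter.1 hy).2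
  have hfib : ∀ c ∈ s.image τ, t₀.filter (fun y => τ' y = c) = t.filter fun y => τ' y = c := by
    intro c hc
    ext y
    simp only [ht₀, Finset.mem_filter]
    constructor
    · rintro ⟨⟨h1, -⟩, h2⟩; exact ⟨h1, h2⟩
    · rintro ⟨h1, rfl⟩; exact ⟨⟨h1, hc⟩, rfl⟩
  have hle : ∀ c ∈ s.image τ,
      (s.filter fun x => τ x = c).card ≤ (t₀.filter fun y => τ' y = c).card := by
    intro c hc
    rw [hfib c hc]
    obtain ⟨a, ha, rfl⟩ := Finset.mem_image.1 hc
    exact h a ha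
  have hst₀ : s.card ≤ t₀.card := by
    rw [hs, ht]; exact Finset.sum_le_sum hle
  have ht₀t : t₀.card ≤ t.card := Finset.card_filter_le _ _
  refine ⟨hst₀.trans ht₀t, fun heq => ⟨fun a ha => ?_, fun b hb => ?_⟩⟩
  · have h1 : ∑ c ∈ s.image τ, (s.filter fun x => τ x = c).card =
        ∑ c ∈ s.image τ, (t₀.filter fun y => τ' y = c).card := by
      rw [← hs, ← ht]; omega
    have hc := Finset.mem_image_of_mem τ ha
    have := (Finset.sum_eq_sum_iff_of_le hle).1 h1 _ hc
    rw [this, hfib _ hc]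
  · have : t₀ = t := Finset.eq_of_subset_of_card_le (Finset.filter_subset _ _) (by omega)
    rw [← this] at hb
    exact Finset.mem_image.1 (Finset.mem_filter.1 hb).2

namespace TriangulatedDiskoid

variable {W : Type*} (D : TriangulatedDiskoid)

noncomputable instance : Fintype D.Dart := @Fintype.ofFinite _ D.finiteDart

instance : Finite D.Vertex := D.finiteVertex

theorem tgt_eq (a : D.Dart) : D.tgt a = D.src (D.next a) := (D.src_next a).symm

theorem tgt_rev (a : D.Dart) : D.tgt (D.rev a) = D.src a := by
  rw [tgt, D.rev_rev]

open Classical in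
/-- The darts with a triangle on their left. -/
noncomputable def innerDarts : Finset D.Dart := Finset.univ.filter fun a => a ∉ D.outer

variable {D}

theorem mem_innerDarts {a : D.Dart} : a ∈ D.innerDarts ↔ a ∉ D.outer := by
  simp [innerDarts]

theorem next_mem_innerDarts {a : D.Dart} : D.next a ∈ D.innerDarts ↔ a ∈ D.innerDarts := by
  rw [mem_innerDarts, mem_innerDarts, D.next_mem_outer]

theorem next_next_next {a : D.Dart} (ha : a ∈ D.innerDarts) :
    D.next (D.next (D.next a)) = a := D.inner_triangle a (mem_innerDarts.1 ha)

theorem src_ne_src_next {a : D.Dart} (ha : a ∈ D.innerDarts) : D.src a ≠ D.src (D.next a) :=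
  D.inner_embedded a (mem_innerDarts.1 ha)

theorem src_next_next_ne_src {a : D.Dart} (ha : a ∈ D.innerDarts) :
    D.src (D.next (D.next a)) ≠ D.src a := by
  have := src_ne_src_next (next_mem_innerDarts.2 (next_mem_innerDarts.2 ha))
  rwa [next_next_next ha] at this

theorem mem_triangle_self (a : D.Dart) : a ∈ D.triangle a := by simp [triangle]

theorem triangle_next {a : D.Dart} (ha : a ∈ D.innerDarts) :
    D.triangle (D.next a) = D.triangle a := by
  rw [triangle, triangle, next_next_next ha, triple_rotate]

theorem triangle_eq_iff {a b : D.Dart} (ha : a ∈ D.innerDarts) :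
    D.triangle b = D.triangle a ↔ b = a ∨ b = D.next a ∨ b = D.next (D.next a) := by
  constructor
  · intro h
    have := mem_triangle_self b
    rw [h] at this
    simpa [triangle] using this
  · rintro (rfl | rfl | rfl)
    · rfl
    · exact triangle_next ha
    · rw [triangle_next (next_mem_innerDarts.2 ha), triangle_next ha]

open Classical in
theorem filter_triangle_eq {a : D.Dart} (ha : a ∈ D.innerDarts) :
    (D.innerDarts.filter fun x => D.triangle x = D.triangle a) =
      {a, D.next a, D.next (D.next a)} := by
  ext x
  simp only [Finset.mem_filter, triangle_eq_iff ha, Finset.mem_insert, Finset.mem_singleton,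
    and_iff_right_iff_imp]
  rintro (rfl | rfl | rfl) <;> simp only [next_mem_innerDarts, ha]

open Classical in
theorem sum_triangle {M : Type*} [AddCommMonoid M] {a : D.Dart} (ha : a ∈ D.innerDarts)
    (F : D.Dart → M) :
    ∑ x ∈ ({a, D.next a, D.next (D.next a)} : Finset D.Dart), F x =
      F a + (F (D.next a) + F (D.next (D.next a))) := by
  have ha' := next_mem_innerDarts.2 ha
  have h1 : a ≠ D.next a := fun h => src_ne_src_next ha (congrArg D.src h)
  have h2 : D.next a ≠ D.next (D.next a) := fun h => src_ne_src_next ha' (congrArg D.src h)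
  have h3 : a ≠ D.next (D.next a) := fun h => src_next_next_ne_src ha (congrArg D.src h.symm)
  rw [Finset.sum_insert (by simp [h1, h3]), Finset.sum_insert (by simp [h2]),
    Finset.sum_singleton]

open Classical in
theorem card_filter_triangle_eq {a : D.Dart} (ha : a ∈ D.innerDarts) :
    (D.innerDarts.filter fun x => D.triangle x = D.triangle a).card = 3 := by
  rw [filter_triangle_eq ha, Finset.card_eq_sum_ones, sum_triangle ha fun _ => 1]
  rfl

theorem card_innerDarts (D : TriangulatedDiskoid) : D.innerDarts.card = 3 * D.area := by
  classical
  have h1 : D.area = (D.innerDarts.image D.triangle).card := by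
    rw [area, triangles, ← Set.ncard_coe_finset]
    congr 1
    ext t
    simp [mem_innerDarts]
  rw [h1, Finset.card_eq_sum_card_image D.triangle, mul_comm, ← smul_eq_mul,
    ← Finset.sum_const]
  refine Finset.sum_congr rfl fun t ht => ?_
  obtain ⟨a, ha, rfl⟩ := Finset.mem_image.1 ht
  exact card_filter_triangle_eq ha

/-- The coboundary of `ψ` on the image under `g` of the triangle to the left of a dart. -/
def triCoboundary (D : TriangulatedDiskoid) (g : D.Vertex → W) (ψ : W → W → ℤ) (a : D.Dart) : ℤ :=
  coboundary ψ (g (D.src a)) (g (D.src (D.next a))) (g (D.src (D.next (D.next a))))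

/-- The image under `g` of the vertices of the triangle to the left of a dart. -/
def triImage (D : TriangulatedDiskoid) (g : D.Vertex → W) (a : D.Dart) : Set W :=
  {g (D.src a), g (D.src (D.next a)), g (D.src (D.next (D.next a)))}

theorem triCoboundary_next {g : D.Vertex → W} {ψ : W → W → ℤ} {a : D.Dart}
    (ha : a ∈ D.innerDarts) : D.triCoboundary g ψ (D.next a) = D.triCoboundary g ψ a := by
  rw [triCoboundary, triCoboundary, next_next_next ha, coboundary_rotate]

theorem triImage_next {g : D.Vertex → W} {a : D.Dart}
    (ha : a ∈ D.innerDarts) : D.triImage g (D.next a) = D.triImage g a := by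
  rw [triImage, triImage, next_next_next ha, triple_rotate]

/-- Stokes' theorem on a diskoid: the total coboundary of `ψ` over the triangles is determined by
the values of `ψ` on the boundary polygon. Each triangle is counted at its three darts, and the
sign comes from the clockwise orientation of the boundary. -/
theorem sum_triCoboundary (D : TriangulatedDiskoid) (g : D.Vertex → W) {ψ : W → W → ℤ}
    (hψ : ∀ x y, ψ x y = -ψ y x) :
    ∑ a ∈ D.innerDarts, D.triCoboundary g ψ a =
      -3 * ∑ᶠ a : D.outer, ψ (g (D.src a)) (g (D.src (D.next a))) := by
  classical
  set F : D.Dart → ℤ := fun a => ψ (g (D.src a)) (g (D.src (D.next a))) with hF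
  have hrev : ∀ a, F (D.rev a) = -F a := fun a => by
    simp only [hF, D.src_next, D.rev_rev]
    exact hψ _ _
  -- The two directions of an edge cancel.
  have hall : ∑ a, F a = 0 := by
    have : ∑ a, F a = ∑ a, F (D.rev a) :=
      (Equiv.sum_comp (Function.Involutive.toPerm D.rev D.rev_rev) F).symm
    simp only [hrev, Finset.sum_neg_distrib] at this
    omega
  have hnext : ∀ G : D.Dart → ℤ, ∑ a ∈ D.innerDarts, G (D.next a) = ∑ a ∈ D.innerDarts, G a :=
    fun G => Finset.sum_equiv D.next (fun a => next_mem_innerDarts.symm) fun _ _ => rfl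
  have hin : ∑ a ∈ D.innerDarts, D.triCoboundary g ψ a = 3 * ∑ a ∈ D.innerDarts, F a := by
    have : ∀ a ∈ D.innerDarts,
        D.triCoboundary g ψ a = F a + F (D.next a) + F (D.next (D.next a)) := fun a ha => by
      simp only [hF, triCoboundary, coboundary, next_next_next ha]
    rw [Finset.sum_congr rfl this, Finset.sum_add_distrib, Finset.sum_add_distrib,
      hnext fun a => F (D.next a), hnext F]
    ring
  have hout : ∑ᶠ a : D.outer, F a = ∑ a with a ∈ D.outer, F a := by
    rw [finsum_eq_sum_of_fintype]
    exact (Finset.sum_subtype _ (by simp) F).symm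
  have hsplit := Finset.sum_filter_add_sum_filter_not Finset.univ (fun a => a ∈ D.outer) F
  rw [hall] at hsplit
  rw [hin, hout]
  have : ∑ a ∈ D.innerDarts, F a = ∑ a with a ∉ D.outer, F a := by
    rw [innerDarts]
  omega

theorem BoundaryIso.coe_next {D' D : TriangulatedDiskoid} (β : BoundaryIso D' D) (a : D'.outer) :
    (β.toEquiv ⟨D'.next a, (D'.next_mem_outer a).2 a.2⟩ : D.Dart) = D.next (β.toEquiv a) :=
  β.map_next _ _ rfl

theorem BoundaryIso.Agree.sum_triCoboundary_eq {D' D : TriangulatedDiskoid}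
    {β : BoundaryIso D' D} {f' : D'.Vertex → W} {f : D.Vertex → W} (h : β.Agree f' f)
    {ψ : W → W → ℤ} (hψ : ∀ x y, ψ x y = -ψ y x) :
    ∑ b ∈ D'.innerDarts, D'.triCoboundary f' ψ b = ∑ a ∈ D.innerDarts, D.triCoboundary f ψ a := by
  rw [sum_triCoboundary D' f' hψ, sum_triCoboundary D f hψ,
    ← finsum_comp_equiv β.toEquiv]
  congr 2
  funext a
  rw [← β.coe_next a, ← h.1 a, ← h.1]

/-! ### The area of an embedded diskoid is least -/

section Embedding

variable {Δ : AbstractSimplicialComplex W} {f : D.Vertex → W}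

theorem IsSimplicialMap.exists_face {g : D.Vertex → W} (hg : D.IsSimplicialMap Δ g) {a : D.Dart}
    (ha : a ∈ D.innerDarts) : ∃ s ∈ Δ.faces, ∀ w, w ∈ s ↔ w ∈ D.triImage g a := by
  classical
  refine ⟨_, hg.2 a (mem_innerDarts.1 ha), fun w => ?_⟩
  simp only [triVerts, triImage, Finset.mem_image, Finset.mem_insert, Finset.mem_singleton,
    Set.mem_insert_iff, Set.mem_singleton_iff, exists_eq_or_imp, exists_eq_left]
  simp only [eq_comm]

theorem IsEmbedding.dart_ext (hf : D.IsEmbedding Δ f) {a b : D.Dart}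
    (h1 : f (D.src a) = f (D.src b)) (h2 : f (D.tgt a) = f (D.tgt b)) : a = b := by
  have h1' := hf.2.1 h1
  have h2' := hf.2.1 h2
  have : D.edgeVerts b = D.edgeVerts a := by simp only [edgeVerts, h1', h2']
  refine (hf.2.2.2.1 b a this).resolve_right ?_
  rintro rfl
  exact hf.2.2.1 b h1'.symm

theorem IsEmbedding.triImage_eq_iff (hf : D.IsEmbedding Δ f) {a b : D.Dart}
    (ha : a ∈ D.innerDarts) (hb : b ∈ D.innerDarts) :
    D.triImage f b = D.triImage f a ↔ D.triangle b = D.triangle a := by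
  constructor
  · intro h
    refine hf.2.2.2.2 b a (mem_innerDarts.1 hb) (mem_innerDarts.1 ha) ?_
    have himg : ∀ x, D.triImage f x = f '' (D.triVerts x : Set D.Vertex) := fun x => by
      simp only [triImage, triVerts, Finset.coe_insert, Finset.coe_singleton,
        Set.image_insert_eq, Set.image_singleton]
    rw [himg, himg] at h
    exact Finset.coe_injective (hf.2.1.image_injective h)
  · rw [triangle_eq_iff ha]
    rintro (rfl | rfl | rfl)
    · rfl
    · exact triImage_next ha
    · rw [triImage_next (next_mem_innerDarts.2 ha), triImage_next ha]

open Classical in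
theorem IsEmbedding.card_filter_triImage (hf : D.IsEmbedding Δ f) {a : D.Dart}
    (ha : a ∈ D.innerDarts) :
    (D.innerDarts.filter fun x => D.triImage f x = D.triImage f a).card = 3 := by
  rw [← card_filter_triangle_eq ha]
  congr 1
  exact Finset.filter_congr fun x hx => hf.triImage_eq_iff ha hx

variable {D' : TriangulatedDiskoid} {f' : D'.Vertex → W} {β : BoundaryIso D' D}

open Classical in
/-- Counted with signs, the triangles of `D'` cover each triangle of an embedded diskoid `D` with
the same boundary exactly once. -/
theorem IsEmbedding.exists_sum_triCoboundary_eq (hΔ : IsAffineBuildingA2 Δ)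
    (hf : D.IsEmbedding Δ f) (hf' : D'.IsSimplicialMap Δ f') (hβ : β.Agree f' f) {a : D.Dart}
    (ha : a ∈ D.innerDarts) :
    ∃ ψ : W → W → ℤ, (∀ x y, ψ x y = -ψ y x) ∧ |D.triCoboundary f ψ a| = 1 ∧
      ∑ b ∈ D'.innerDarts with D'.triImage f' b = D.triImage f a, D'.triCoboundary f' ψ b =
        3 * D.triCoboundary f ψ a := by
  obtain ⟨s, hs, hsa⟩ := hf.1.exists_face ha
  obtain ⟨ψ, hψ, hone, hzero⟩ := hΔ.exists_cochain (c₀ := f (D.src a))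
    (c₁ := f (D.src (D.next a))) (c₂ := f (D.src (D.next (D.next a))))
    (fun t ht => by
      have : t = s := by ext w; rw [ht, hsa]; rfl
      exact this ▸ hs)
    (hf.2.1.ne (src_ne_src_next ha)) (hf.2.1.ne (src_ne_src_next (next_mem_innerDarts.2 ha)))
    (hf.2.1.ne (src_next_next_ne_src ha))
  refine ⟨ψ, hψ, hone, ?_⟩
  have hsupp : ∀ {E : TriangulatedDiskoid} {g : E.Vertex → W}, E.IsSimplicialMap Δ g →
      ∀ b ∈ E.innerDarts, E.triCoboundary g ψ b ≠ 0 → E.triImage g b = D.triImage f a := by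
    intro E g hg b hb hne
    obtain ⟨t, ht, htb⟩ := hg.exists_face hb
    exact hzero t ht _ ((htb _).2 (by simp [triImage])) _ ((htb _).2 (by simp [triImage])) _
      ((htb _).2 (by simp [triImage])) hne
  rw [Finset.sum_filter_of_ne (hsupp hf'), hβ.sum_triCoboundary_eq hψ,
    ← Finset.sum_filter_of_ne (hsupp hf.1),
    Finset.filter_congr fun x hx => hf.triImage_eq_iff ha hx, filter_triangle_eq ha,
    sum_triangle ha, triCoboundary_next (next_mem_innerDarts.2 ha), triCoboundary_next ha]
  ring

/-- The dart `b` and the triangle to its left have the same images as the dart `a` and the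
triangle to its left, vertex by vertex. -/
def SameImage (f' : D'.Vertex → W) (f : D.Vertex → W) (b : D'.Dart) (a : D.Dart) : Prop :=
  f' (D'.src b) = f (D.src a) ∧ f' (D'.src (D'.next b)) = f (D.src (D.next a)) ∧
    f' (D'.src (D'.next (D'.next b))) = f (D.src (D.next (D.next a)))

/-- A triangle of `D'` with the same vertices in the building as a triangle of `D` either
degenerates, or it has the opposite orientation, or the two match after a rotation. -/
theorem triCoboundary_cases {ψ : W → W → ℤ} (hψ : ∀ x y, ψ x y = -ψ y x) {a : D.Dart}
    (ha : a ∈ D.innerDarts) {b : D'.Dart} (h : D'.triImage f' b = D.triImage f a) :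
    D'.triCoboundary f' ψ b = 0 ∨ D'.triCoboundary f' ψ b = -D.triCoboundary f ψ a ∨
      D'.triCoboundary f' ψ b = D.triCoboundary f ψ a ∧
        ∃ c ∈ D.innerDarts, SameImage f' f b c := by
  have ha' := next_mem_innerDarts.2 ha
  have key : ∀ c ∈ D.innerDarts, D.triCoboundary f ψ c = D.triCoboundary f ψ a →
      SameImage f' f b c → D'.triCoboundary f' ψ b = D.triCoboundary f ψ a ∧
        ∃ c ∈ D.innerDarts, SameImage f' f b c := fun c hc hca hbc =>
    ⟨by rw [← hca, triCoboundary, triCoboundary, hbc.1, hbc.2.1, hbc.2.2], c, hc, hbc⟩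
  rcases coboundary_eq_zero_or_eq_or_eq_neg hψ h with h | h | h | h | h
  · exact Or.inl h
  · exact Or.inr (Or.inr (key a ha rfl h))
  · refine Or.inr (Or.inr (key (D.next a) ha' (triCoboundary_next ha) ?_))
    rw [SameImage, next_next_next ha]
    exact h
  · refine Or.inr (Or.inr (key (D.next (D.next a)) (next_mem_innerDarts.2 ha') ?_ ?_))
    · rw [triCoboundary_next ha', triCoboundary_next ha]
    · rw [SameImage, next_next_next ha]
      exact h
  · exact Or.inr (Or.inl h)

open Classical in
/-- Each triangle of an embedded diskoid `D` is covered by `D'`, and if it is covered only once,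
then with the right orientation. -/
theorem IsEmbedding.three_le_card_filter (hΔ : IsAffineBuildingA2 Δ)
    (hf : D.IsEmbedding Δ f) (hf' : D'.IsSimplicialMap Δ f') (hβ : β.Agree f' f) {a : D.Dart}
    (ha : a ∈ D.innerDarts) :
    3 ≤ (D'.innerDarts.filter fun b => D'.triImage f' b = D.triImage f a).card ∧
      ((D'.innerDarts.filter fun b => D'.triImage f' b = D.triImage f a).card = 3 →
        ∀ b ∈ D'.innerDarts, D'.triImage f' b = D.triImage f a →
          ∃ c ∈ D.innerDarts, SameImage f' f b c) := by
  obtain ⟨ψ, hψ, hone, hsum⟩ := hf.exists_sum_triCoboundary_eq hΔ hf' hβ ha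
  set M := D'.innerDarts.filter fun b => D'.triImage f' b = D.triImage f a with hM
  set ε := D.triCoboundary f ψ a with hε
  have hεε : ε * ε = 1 := by rw [← abs_mul_abs_self, hone, one_mul]
  have hle : ∀ b ∈ M, ε * D'.triCoboundary f' ψ b ≤ 1 := fun b hb => by
    rcases triCoboundary_cases hψ ha (Finset.mem_filter.1 hb).2 with h | h | ⟨h, -⟩
    · rw [h, mul_zero]; exact zero_le_one
    · rw [h, mul_neg, hεε]; decide
    · rw [h, hεε]
  have hsum' : ∑ b ∈ M, ε * D'.triCoboundary f' ψ b = 3 := by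
    rw [← Finset.mul_sum, hsum, mul_left_comm, hεε, mul_one]
  refine ⟨?_, fun hcard b hb hba => ?_⟩
  · have := Finset.sum_le_sum hle
    rw [hsum', Finset.sum_const, nsmul_eq_mul, mul_one] at this
    exact_mod_cast this
  · have heq : ∑ b ∈ M, ε * D'.triCoboundary f' ψ b = ∑ b ∈ M, (1 : ℤ) := by
      rw [hsum', Finset.sum_const, hcard]; rfl
    have h1 := (Finset.sum_eq_sum_iff_of_le hle).1 heq b (Finset.mem_filter.2 ⟨hb, hba⟩)
    rcases triCoboundary_cases hψ ha hba with h | h | ⟨-, h⟩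
    · rw [h, mul_zero] at h1; exact absurd h1 (by decide)
    · rw [h, mul_neg, hεε] at h1; exact absurd h1 (by decide)
    · exact h

/-- An embedded diskoid `D` has least area, since `D'` covers each triangle of `D`. If the areas
are equal, then each triangle is covered only once, and no triangle of `D'` is left over, so that
the triangles match. -/
theorem IsEmbedding.area_le (hΔ : IsAffineBuildingA2 Δ)
    (hf : D.IsEmbedding Δ f) (hf' : D'.IsSimplicialMap Δ f') (hβ : β.Agree f' f) :
    D.area ≤ D'.area ∧ (D'.area = D.area →
      (∀ b ∈ D'.innerDarts, ∃ a ∈ D.innerDarts, SameImage f' f b a) ∧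
      ∀ a ∈ D.innerDarts, ∃ b ∈ D'.innerDarts, SameImage f' f b a) := by
  classical
  have hcov := fun a (ha : a ∈ D.innerDarts) => hf.three_le_card_filter hΔ hf' hβ ha
  obtain ⟨hle, heq⟩ := card_le_card_of_fiber_le D.innerDarts D'.innerDarts (D.triImage f)
    (D'.triImage f') fun a ha => by
      rw [hf.card_filter_triImage ha]; exact (hcov a ha).1
  rw [card_innerDarts, card_innerDarts] at hle heq
  refine ⟨by omega, fun harea => ?_⟩
  obtain ⟨hfib, hex⟩ := heq (by omega)
  have hfib' := fun a (ha : a ∈ D.innerDarts) =>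
    (hfib a ha).trans (hf.card_filter_triImage ha)
  refine ⟨fun b hb => ?_, fun a ha => ?_⟩
  · obtain ⟨a, ha, hab⟩ := hex b hb
    exact (hcov a ha).2 (hfib' a ha) b hb hab.symm
  · obtain ⟨b, hb⟩ := Finset.card_pos.1 (by rw [hfib' a ha]; norm_num :
      0 < (D'.innerDarts.filter fun b => D'.triImage f' b = D.triImage f a).card)
    replace ⟨hb, hba⟩ := Finset.mem_filter.1 hb
    obtain ⟨c, hc, hbc⟩ := (hcov a ha).2 (hfib' a ha) b hb hba
    have hca : D.triImage f a = D.triImage f c := by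
      rw [← hba, triImage, triImage, hbc.1, hbc.2.1, hbc.2.2]
    rw [hf.triImage_eq_iff hc ha, triangle_eq_iff hc] at hca
    have hb' := next_mem_innerDarts.2 hb
    rcases hca with rfl | rfl | rfl
    · exact ⟨b, hb, hbc⟩
    · refine ⟨D'.next b, hb', ?_⟩
      rw [SameImage, next_next_next hb, next_next_next hc]
      exact ⟨hbc.2.1, hbc.2.2, hbc.1⟩
    · refine ⟨D'.next (D'.next b), next_mem_innerDarts.2 hb', ?_⟩
      rw [SameImage, next_next_next hb, next_next_next hc]
      exact ⟨hbc.2.2, hbc.1, hbc.2.1⟩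

end Embedding

/-! ### Isomorphisms of diskoids from matchings of darts -/

section Rigidity

theorem src_iterate_rotation (D : TriangulatedDiskoid) (k : ℕ) (a : D.Dart) :
    D.src ((fun c => D.next (D.rev c))^[k] a) = D.src a := by
  induction k generalizing a with
  | zero => rfl
  | succ k ih => rw [Function.iterate_succ_apply, ih, D.src_next, D.rev_rev]

theorem BoundaryIso.card_dart_eq {D' D : TriangulatedDiskoid} (β : BoundaryIso D' D)
    (h : D'.area = D.area) : Fintype.card D'.Dart = Fintype.card D.Dart := by
  classical
  have key : ∀ E : TriangulatedDiskoid, Fintype.card E.Dart = Nat.card E.outer + 3 * E.area :=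
    fun E => by
      rw [← card_innerDarts, innerDarts, Nat.card_eq_fintype_card, Fintype.card_subtype,
        Finset.card_filter_add_card_filter_not, Finset.card_univ]
  rw [key, key, h, Nat.card_congr β.toEquiv]

/-- A diskoid with an isolated vertex is a point. -/
theorem eq_of_forall_src_ne {D : TriangulatedDiskoid} {v : D.Vertex} (hv : ∀ a, D.src a ≠ v)
    (w : D.Vertex) : w = v := by
  rcases Relation.ReflTransGen.cases_head (D.connected v w) with h | ⟨_, ⟨a, ha, -⟩, -⟩
  · exact h.symm
  · exact absurd ha (hv a)

variable {Δ : AbstractSimplicialComplex W} {f : D.Vertex → W} {D' : TriangulatedDiskoid}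
  {f' : D'.Vertex → W} {β : BoundaryIso D' D}

/-- If the triangles of `D'` and of the embedded diskoid `D` match, then every dart of `D'` goes
to a dart of `D`, and these maps preserve the combinatorial structure. A dart of `D` is
determined by the images of its endpoints, so the matching on the boundary polygons and that on
the triangles fit together. -/
theorem IsEmbedding.exists_iso (hf : D.IsEmbedding Δ f) (hβ : β.Agree f' f)
    (harea : D'.area = D.area)
    (h1 : ∀ b ∈ D'.innerDarts, ∃ a ∈ D.innerDarts, SameImage f' f b a)
    (h2 : ∀ a ∈ D.innerDarts, ∃ b ∈ D'.innerDarts, SameImage f' f b a) :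
    ∃ φ : Iso D' D, (∀ v, f (φ.vertexEquiv v) = f' v) ∧
      ∀ a : D'.outer, φ.dartEquiv a = β.toEquiv a := by
  classical
  have hβtgt : ∀ b : D'.outer, f (D.tgt (β.toEquiv b)) = f' (D'.tgt b) := fun b => by
    rw [tgt_eq, tgt_eq, ← β.coe_next, ← hβ.1]
  have hex : ∀ b, ∃ a, f (D.src a) = f' (D'.src b) ∧ f (D.tgt a) = f' (D'.tgt b) := fun b => by
    by_cases hb : b ∈ D'.outer
    · exact ⟨β.toEquiv ⟨b, hb⟩, (hβ.1 ⟨b, hb⟩).symm, hβtgt ⟨b, hb⟩⟩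
    · obtain ⟨a, -, ha⟩ := h1 b (mem_innerDarts.2 hb)
      exact ⟨a, ha.1.symm, by rw [tgt_eq, tgt_eq, ha.2.1]⟩
  choose φ hsrc htgt using hex
  have huniq : ∀ a b, f (D.src a) = f' (D'.src b) → f (D.tgt a) = f' (D'.tgt b) → φ b = a :=
    fun a b ha hb => hf.dart_ext ((hsrc b).trans ha.symm) ((htgt b).trans hb.symm)
  have houter : ∀ b : D'.outer, φ b = β.toEquiv b := fun b =>
    huniq _ _ (hβ.1 b).symm (hβtgt b)
  have hinner : ∀ b a, SameImage f' f b a → φ b = a := fun b a hba =>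
    huniq _ _ hba.1.symm (by rw [tgt_eq, tgt_eq, hba.2.1])
  have hrev : ∀ b, D.rev (φ b) = φ (D'.rev b) := fun b =>
    (huniq _ _ (htgt b) (by rw [tgt_rev, tgt_rev]; exact hsrc b)).symm
  have hnext : ∀ b, D.next (φ b) = φ (D'.next b) := fun b => by
    by_cases hb : b ∈ D'.outer
    · rw [houter ⟨b, hb⟩, ← β.coe_next ⟨b, hb⟩]
      exact (houter ⟨D'.next b, _⟩).symm
    · obtain ⟨a, -, ha⟩ := h1 b (mem_innerDarts.2 hb)
      rw [hinner b a ha]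
      exact (huniq _ _ ha.2.1.symm (by rw [tgt_eq, tgt_eq, ha.2.2])).symm
  have hmem : ∀ b, φ b ∈ D.outer ↔ b ∈ D'.outer := fun b => by
    by_cases hb : b ∈ D'.outer
    · rw [houter ⟨b, hb⟩]
      exact iff_of_true (β.toEquiv ⟨b, hb⟩).2 hb
    · obtain ⟨a, ha, hba⟩ := h1 b (mem_innerDarts.2 hb)
      rw [hinner b a hba]
      exact iff_of_false (mem_innerDarts.1 ha) hb
  have hbij : Function.Bijective φ := by
    refine (Fintype.bijective_iff_surjective_and_card φ).2
      ⟨fun a => ?_, β.card_dart_eq harea⟩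
    by_cases ha : a ∈ D.outer
    · exact ⟨β.toEquiv.symm ⟨a, ha⟩, by rw [houter, Equiv.apply_symm_apply]⟩
    · obtain ⟨b, -, hb⟩ := h2 a (mem_innerDarts.2 ha)
      exact ⟨b, hinner b a hb⟩
  have hvex : ∀ v', ∃ v, f v = f' v' := fun v' => by
    by_cases h : ∃ b, D'.src b = v'
    · obtain ⟨b, rfl⟩ := h
      exact ⟨D.src (φ b), hsrc b⟩
    · simp only [not_exists] at h
      obtain ⟨v⟩ := D.nonempty
      have : IsEmpty D'.Dart := ⟨fun b => h b (eq_of_forall_src_ne h _)⟩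
      exact ⟨v, (hβ.2 this v' v).symm⟩
  choose φv hφv using hvex
  have hφsrc : ∀ b, D.src (φ b) = φv (D'.src b) := fun b =>
    hf.2.1 ((hsrc b).trans (hφv _).symm)
  have hvbij : Function.Bijective φv := by
    refine ⟨fun v w hvw => ?_, fun v => ?_⟩
    · by_cases hv : ∃ b, D'.src b = v
      · by_cases hw : ∃ c, D'.src c = w
        · obtain ⟨b, rfl⟩ := hv
          obtain ⟨c, rfl⟩ := hw
          rw [← hφsrc, ← hφsrc] at hvw
          -- Rotation about the common image lifts to rotation about a vertex of `D'`.
          obtain ⟨k, hk⟩ := D.rotation _ _ hvw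
          have hsemi : Function.Semiconj φ (fun c => D'.next (D'.rev c))
              (fun c => D.next (D.rev c)) := fun x => by
            simp only [hrev, hnext]
          rw [← (hsemi.iterate_right k).eq b] at hk
          rw [← hbij.1 hk, src_iterate_rotation]
        · simp only [not_exists] at hw
          exact eq_of_forall_src_ne hw v
      · simp only [not_exists] at hv
        exact (eq_of_forall_src_ne hv w).symm
    · by_cases hv : ∃ a, D.src a = v
      · obtain ⟨a, rfl⟩ := hv
        obtain ⟨b, rfl⟩ := hbij.2 a
        exact ⟨_, (hφsrc b).symm⟩
      · simp only [not_exists] at hv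
        obtain ⟨v'⟩ := D'.nonempty
        exact ⟨v', eq_of_forall_src_ne hv _⟩
  exact ⟨⟨Equiv.ofBijective φv hvbij, Equiv.ofBijective φ hbij, hφsrc, hrev, hnext, hmem⟩,
    hφv, houter⟩

end Rigidity

end TriangulatedDiskoid

theorem mainTheorem12 {W : Type*} (Δ : AbstractSimplicialComplex W) (hΔ : IsAffineBuildingA2 Δ)
    (D : TriangulatedDiskoid) (hA : D.IsTypeA2) (hcat : D.IsCAT0)
    (f : D.Vertex → W) (hf : D.IsEmbedding Δ f)
    (D' : TriangulatedDiskoid) (f' : D'.Vertex → W) (hf' : D'.IsSimplicialMap Δ f')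
    (β : TriangulatedDiskoid.BoundaryIso D' D) (hβ : β.Agree f' f) :
    D.area ≤ D'.area ∧
    (D'.area = D.area → ∃ φ : TriangulatedDiskoid.Iso D' D,
      (∀ v, f (φ.vertexEquiv v) = f' v) ∧
      (∀ a : D'.outer, φ.dartEquiv a = β.toEquiv a)) := by
  obtain ⟨hle, hmatch⟩ := hf.area_le hΔ hf' hβ
  exact ⟨hle, fun harea => hf.exists_iso hβ harea (hmatch harea).1 (hmatch harea).2⟩
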